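/- Let $\ell$ be a prime, $r\ge 1$ and $N\ge 0$ integers, $\Lambda=W(\mathbb{F}_{\ell^r})$ the ring of Witt vectors with its $\ell$-adic topology, and $R=\Lambda[[x_1,\dots,x_N]]$ with its $(\ell,x_1,\dots,x_N)$-adic topology. Let $\mathbb{C}_\ell$ be the completion of an algebraic closure of $\mathbb{Q}_\ell$, with $|\ell|=1/\ell$, and $\mathscr{O}_{\mathbb{C}_\ell}$ its ring of integers. A point of $U(R)$ is a continuous ring homomorphism $z:R\to\mathbb{C}_\ell$. For real $c>0$ let $U_c(R)\subset U(R)$ be the set of points $z$ with $|z(x_i)|\le \ell^{-c}$ for all $i$. For an ideal $I\subset \mathscr{O}_{\mathbb{C}_\ell}[[x_1,\dots,x_N]]$ let $V(I)\subset U(R)$ be the set of points $z$ such that $f(z(x_1),\dots,z(x_N))=0$ for all $f\in I$ (these series converge). A continuous ring automorphism $\varphi$ of $R$ acts on points by $\varphi(z)=z\circ\varphi$. A set $A\subset\mathbb{Z}_{\ge 0}$ is semilinear with period $M\geq 1$ if $A=S\cup\{a+jM\mid a\in T,\ j\in\mathbb{Z}_{\ge 0}\}$ for some finite set $S\subset\mathbb{Z}_{\ge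 0}$ and some $T\subset\{0,1,\dots,M-1\}$. Let $c$ be a real number with $0<c<1$. Then there is an integer $M=M(c,\ell^r,N)\ge 1$, depending only on $c$, $\ell^r$ and $N$, such that for every continuous ring automorphism $\varphi$ of $R$, every $z\in U_c(R)$ and every ideal $I\subset\mathscr{O}_{\mathbb{C}_\ell}[[x_1,\dots,x_N]]$, the set $$\{m\in\mathbb{Z}_{\ge 0}\mid \varphi^m(z)\in V(I)\}$$ is semilinear with period $M$. -/

import Mathlib

open scoped MvPowerSeries.WithPiTopology

namespace LocalMordellLang

/-- `Λ = W(𝔽_{ℓ^r})`, the ring of `ℓ`-typical Witt vectors of the field with `ℓ^r` elements. -/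
abbrev Lam (ℓ : ℕ) [Fact ℓ.Prime] (r : ℕ) : Type := WittVector ℓ (GaloisField ℓ r)

/-- The `ℓ`-adic topology on `Λ`, i.e. the topology of the absolute value with `|ℓ| = 1/ℓ`. -/
noncomputable instance instTopologicalSpaceLam (ℓ : ℕ) [Fact ℓ.Prime] (r : ℕ) : TopologicalSpace (Lam ℓ r) :=
  (Ideal.span {(ℓ : Lam ℓ r)}).adicTopology

/-- `R = Λ[[x_1, …, x_N]]`. Its topology is that of coefficientwise `ℓ`-adic convergence; since
`N` is finite this is the adic topology of the maximal ideal `(ℓ, x_1, …, x_N)`. -/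
abbrev PowerSeriesRing (ℓ : ℕ) [Fact ℓ.Prime] (r N : ℕ) : Type :=
  MvPowerSeries (Fin N) (Lam ℓ r)

/-- A `ℂ_ℓ`-point of the rigid generic fibre `U(R)` of `R = Λ[[x_1, …, x_N]]`: a continuous ring
homomorphism `R → ℂ_ℓ`. Points over finite extensions of `ℚ_ℓ` inside `ℂ_ℓ` are among these. -/
structure Point (ℓ : ℕ) [Fact ℓ.Prime] (r N : ℕ) where
  /-- the underlying ring homomorphism -/
  hom : PowerSeriesRing ℓ r N →+* ℂ_[ℓ]
  continuous_hom : Continuous hom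

section

variable {ℓ : ℕ} [Fact ℓ.Prime] {r N : ℕ}

/-- The `i`-th coordinate `z(x_i)` of the point `z`. -/
noncomputable def Point.coord (z : Point ℓ r N) (i : Fin N) : ℂ_[ℓ] :=
  z.hom (MvPowerSeries.X i)

variable (ℓ r N) in
/-- The closed ball `U_c(R)` of radius `ℓ^{-c}`: the points `z` with `|z(x_i)| ≤ ℓ^{-c}` for
all `i`. -/
def closedBall (c : ℝ) : Set (Point ℓ r N) :=
  {z | ∀ i, ‖z.coord i‖ ≤ (ℓ : ℝ) ^ (-c)}

/-- The point `z` kills the power series `f` over the ring of integers of `ℂ_ℓ`: the series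
`f(z(x_1), …, z(x_N))` sums to `0`. (It always converges, as `|z(x_i)| < 1`.) -/
def Point.Kills (z : Point ℓ r N) (f : MvPowerSeries (Fin N) 𝓞_ℂ_[ℓ]) : Prop :=
  HasSum (fun d : Fin N →₀ ℕ => ((MvPowerSeries.coeff d f : 𝓞_ℂ_[ℓ]) : ℂ_[ℓ]) * ∏ i, z.coord i ^ d i) 0

variable (r) in
/-- The closed analytic subset `V(I) = {z | z(I) = {0}}` of `U(R)`. -/
def vanishingLocus (I : Ideal (MvPowerSeries (Fin N) 𝓞_ℂ_[ℓ])) : Set (Point ℓ r N) :=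
  {z | ∀ f ∈ I, z.Kills f}

/-- The self-map `z ↦ φ(z) = z ∘ φ` of `U(R)` induced by a continuous automorphism `φ` of `R`. -/
noncomputable def Point.map (φ : PowerSeriesRing ℓ r N ≃+* PowerSeriesRing ℓ r N) (hφ : Continuous φ)
    (z : Point ℓ r N) : Point ℓ r N where
  hom := z.hom.comp (φ : PowerSeriesRing ℓ r N →+* PowerSeriesRing ℓ r N)
  continuous_hom := z.continuous_hom.comp hφ

end

/-- `A ⊆ ℤ_{≥ 0}` is semilinear with period `M`: it is the union of a finite set `S` and of the
classes `{a + jM | j ≥ 0}` with `a` in a set `T ⊆ {0, …, M - 1}`. -/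
def IsSemilinearWithPeriod (M : ℕ) (A : Set ℕ) : Prop :=
  ∃ S T : Finset ℕ, (∀ a ∈ T, a < M) ∧ A = {m | m ∈ S ∨ ∃ a ∈ T, ∃ j : ℕ, m = a + j * M}

end LocalMordellLang

/-!
Let `𝔪` be the maximal ideal of `R`. Since `R ⧸ 𝔪 ^ (s + 1)` is finite, some `M` depending only on
`R` and `s` makes `ψ = φ ^ M` the identity modulo `𝔪 ^ (s + 1)` for every automorphism `φ`; then
`ψ - 1` maps `𝔪 ^ n` into `𝔪 ^ (n + s)`. If `z` has absolute value at most `ρ < 1` on `𝔪`, the `j`-th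
forward difference of `n ↦ f(z ∘ ψ ^ n)` is therefore `O(ρ ^ (s * j))`. Choosing `s` with
`ρ ^ s < 1 / ℓ` beats the bound `ℓ ^ (-j) ≤ |j !|`, so the coefficients of the Newton expansion of this
sequence in falling factorials tend to zero. As in Strassmann's theorem, such a sequence is zero or
has finitely many zeros, and this applies in each residue class modulo `M`.
-/

namespace LocalMordellLang

section Newton

open Filter Polynomial Topology
open scoped Nat

theorem sum_mul_coeff_modByMonic_eq_zero {K ι : Type*} [Field K] [CharZero K] {t : Finset ι}
    {β : ι → K} {P : ι → ℤ[X]} {s : Finset ℤ}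
    (hs : ∀ n ∈ s, ∑ j ∈ t, β j * (((P j).eval n : ℤ) : K) = 0) (i : ℕ) :
    ∑ j ∈ t, β j * ((P j %ₘ ∏ n ∈ s, (X - C n)).coeff i : K) = 0 := by
  set W : ℤ[X] := ∏ n ∈ s, (X - C n) with hW
  have hWm : W.Monic := monic_prod_of_monic _ _ fun n _ => monic_X_sub_C n
  let G : K[X] := ∑ j ∈ t, β j • (P j).map (Int.castRingHom K)
  have hdvd : W.map (Int.castRingHom K) ∣ G := by
    rw [hW, Polynomial.map_prod]
    refine Finset.prod_dvd_of_coprime (fun a _ b _ hab => ?_) fun n hn => ?_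
    · simpa using isCoprime_X_sub_C_of_isUnit_sub
        (sub_ne_zero.2 (Int.cast_injective.ne hab) : (a : K) - b ≠ 0).isUnit
    · rw [Polynomial.map_sub, map_X, map_C, dvd_iff_isRoot, IsRoot.def, ← hs n hn]
      simp [G, eval_finsetSum]
  have hmod : G %ₘ W.map (Int.castRingHom K) =
      ∑ j ∈ t, β j • (P j %ₘ W).map (Int.castRingHom K) := by
    simp only [G, ← modByMonicHom_apply, map_sum, map_smul]
    simp only [modByMonicHom_apply, map_modByMonic _ hWm]
  rw [(modByMonic_eq_zero_iff_dvd (hWm.map _)).2 hdvd] at hmod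
  simpa [finsetSum_coeff] using (congrArg (fun p : K[X] => p.coeff i) hmod).symm

theorem eq_sum_range_fwdDiff_div_factorial_mul_descPochhammer {K : Type*} [Field K] [CharZero K]
    (u : ℕ → K) {n B : ℕ} (hn : n < B) :
    u n = ∑ j ∈ Finset.range B,
      (fwdDiff 1)^[j] u 0 / (j ! : K) * (((descPochhammer ℤ j).eval (n : ℤ) : ℤ) : K) := by
  have hterm : ∀ j, (fwdDiff 1)^[j] u 0 / (j ! : K) *
      (((descPochhammer ℤ j).eval (n : ℤ) : ℤ) : K) =
        n.choose j • (fwdDiff 1)^[j] u 0 := fun j => by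
    have : (j ! : K) ≠ 0 := Nat.cast_ne_zero.2 j.factorial_ne_zero
    rw [descPochhammer_eval_eq_descFactorial, Nat.descFactorial_eq_factorial_mul_choose,
      nsmul_eq_mul]
    push_cast
    field_simp
  calc u n = ∑ j ∈ Finset.range (n + 1), n.choose j • (fwdDiff 1)^[j] u 0 := by
        simpa using shift_eq_sum_fwdDiff_iter 1 u n 0
    _ = ∑ j ∈ Finset.range B, n.choose j • (fwdDiff 1)^[j] u 0 := by
        refine Finset.sum_subset (Finset.range_subset_range.2 hn) fun j _ hj => ?_
        rw [Nat.choose_eq_zero_of_lt (by simpa using hj), zero_smul]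
    _ = _ := Finset.sum_congr rfl fun j _ => (hterm j).symm

variable {K : Type*} [NormedField K] [IsUltrametricDist K]

theorem card_le_of_forall_sum_eval_eq_zero [CharZero K] {β : ℕ → K} {P : ℕ → ℤ[X]}
    (hP : ∀ j, (P j).Monic) (hdeg : ∀ j, (P j).natDegree = j) {J B : ℕ} (hJB : J < B)
    (hβ : ∀ j, J < j → ‖β j‖ < ‖β J‖) {s : Finset ℤ}
    (hs : ∀ n ∈ s, ∑ j ∈ Finset.range B, β j * (((P j).eval n : ℤ) : K) = 0) : s.card ≤ J := by
  -- Reducing the `P j` modulo `∏ n ∈ s, (X - n)` keeps the coefficients integral and changes no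
  -- `P j` with `j ≤ J < #s`, so `β J` strictly dominates the coefficient of `X ^ J`.
  by_contra! hcard
  have hβJ : 0 < ‖β J‖ := (norm_nonneg _).trans_lt (hβ _ J.lt_succ_self)
  set W : ℤ[X] := ∏ n ∈ s, (X - C n)
  have hWm : W.Monic := monic_prod_of_monic _ _ fun n _ => monic_X_sub_C n
  have hWdeg : W.natDegree = s.card := natDegree_finsetProd_X_sub_C_eq_card s _
  have hself : ∀ j ≤ J, P j %ₘ W = P j := fun j hj => by
    rw [modByMonic_eq_self_iff hWm]
    exact degree_lt_degree (by rw [hdeg, hWdeg]; omega)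
  have hlead : β J * ((P J %ₘ W).coeff J : K) = β J := by
    have : (P J).coeff J = 1 := by simpa [Monic, leadingCoeff, hdeg] using hP J
    rw [hself J le_rfl, this, Int.cast_one, mul_one]
  have hother : ∀ j ∈ Finset.range B, j ≠ J →
      ‖β j * ((P j %ₘ W).coeff J : K)‖ < ‖β J * ((P J %ₘ W).coeff J : K)‖ := fun j _ hj => by
    rw [hlead]
    rcases hj.lt_or_gt with hlt | hgt
    · rw [hself j hlt.le, coeff_eq_zero_of_natDegree_lt (by rwa [hdeg])]
      simpa using hβJ
    · rw [norm_mul]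
      exact (mul_le_of_le_one_right (norm_nonneg _)
        (IsUltrametricDist.norm_intCast_le_one K _)).trans_lt (hβ j hgt)
  have hdom := IsNonarchimedean.apply_sum_eq_of_lt IsUltrametricDist.isNonarchimedean_norm
    (fun a => (norm_neg a).symm) (Finset.mem_range.2 hJB) hother
  rw [sum_mul_coeff_modByMonic_eq_zero hs, norm_zero, hlead] at hdom
  exact hβJ.ne hdom

theorem exists_forall_gt_norm_lt {E : Type*} [NormedAddCommGroup E] {β : ℕ → E}
    (hβ : Tendsto β atTop (𝓝 0)) {i : ℕ} (hi : β i ≠ 0) : ∃ J, ∀ j, J < j → ‖β j‖ < ‖β J‖ := by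
  have hfin : {j | ‖β i‖ ≤ ‖β j‖}.Finite := by
    have := hβ.norm.eventually_lt_const (norm_zero (E := E) ▸ norm_pos_iff.2 hi)
    rw [← Nat.cofinite_eq_atTop, eventually_cofinite] at this
    simpa using this
  obtain ⟨J, hJ, hmax⟩ := Set.exists_max_image _ id hfin ⟨i, le_refl ‖β i‖⟩
  refine ⟨J, fun j hj => ?_⟩
  by_contra! h
  exact hj.not_ge (hmax j (le_trans hJ h))

theorem finite_or_eq_univ_setOf_eq_zero [CharZero K] {u : ℕ → K}
    (hu : Tendsto (fun j => (fwdDiff 1)^[j] u 0 / (j ! : K)) atTop (𝓝 0)) :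
    {n | u n = 0}.Finite ∨ {n | u n = 0} = Set.univ := by
  by_cases h : ∀ j, (fwdDiff 1)^[j] u 0 / (j ! : K) = 0
  · refine .inr (Set.eq_univ_of_forall fun n => ?_)
    simpa [h] using eq_sum_range_fwdDiff_div_factorial_mul_descPochhammer u n.lt_succ_self
  left
  push Not at h
  obtain ⟨i, hi⟩ := h
  obtain ⟨J, hJ⟩ := exists_forall_gt_norm_lt hu hi
  by_contra hinf
  obtain ⟨s, hs, hcard⟩ := Set.Infinite.exists_subset_card_eq hinf (J + 1)
  have hle := card_le_of_forall_sum_eval_eq_zero (s := s.map Nat.castEmbedding)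
    (B := J + 1 + s.sup id + 1) (fun j => monic_descPochhammer ℤ j)
    (fun j => descPochhammer_natDegree ℤ j) (by omega) hJ ?_
  · rw [Finset.card_map, hcard] at hle
    omega
  rw [Finset.forall_mem_map]
  intro n hn
  have hnB : n ≤ s.sup id := Finset.le_sup (f := id) hn
  exact (eq_sum_range_fwdDiff_div_factorial_mul_descPochhammer u (by omega)).symm.trans (hs hn)

end Newton

section ForwardDifference

theorem hasSum_fwdDiff_iterate {M G ι : Type*} [AddCommMonoid M] [AddCommGroup G]
    [TopologicalSpace G] [IsTopologicalAddGroup G] {f : ι → M → G} {u : M → G}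
    (hf : ∀ m, HasSum (fun i => f i m) (u m)) (h : M) (j : ℕ) (m : M) :
    HasSum (fun i => (fwdDiff h)^[j] (f i) m) ((fwdDiff h)^[j] u m) := by
  induction j generalizing m with
  | zero => exact hf m
  | succ j ih =>
    simp only [Function.iterate_succ_apply', fwdDiff]
    exact (ih (m + h)).sub (ih m)

theorem fwdDiff_iterate_map_iterate {G H E F : Type*} [AddCommGroup G] [AddCommGroup H]
    [FunLike E G G] [AddMonoidHomClass E G G] [FunLike F G H] [AddMonoidHomClass F G H]
    (ψ : E) (z : F) (x : G) (j : ℕ) :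
    (fwdDiff 1)^[j] (fun n : ℕ => z (ψ^[n] x)) =
      fun n => z (ψ^[n] ((fun y => ψ y - y)^[j] x)) := by
  induction j generalizing x with
  | zero => rfl
  | succ j ih =>
    rw [Function.iterate_succ_apply, Function.iterate_succ_apply, ← ih]
    congr 1 with n
    rw [fwdDiff, Function.iterate_succ_apply, iterate_map_sub, map_sub]

end ForwardDifference

section AdicFiltration

variable {R : Type*} [CommRing R] {𝔞 : Ideal R} {s : ℕ} {ψ : R →+* R}

theorem map_mem_pow (hψ : ∀ x, ψ x - x ∈ 𝔞) {n : ℕ} {x : R} (hx : x ∈ 𝔞 ^ n) :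
    ψ x ∈ 𝔞 ^ n := by
  have h𝔞 : 𝔞.map ψ ≤ 𝔞 := Ideal.map_le_iff_le_comap.2 fun y hy => by
    simpa using add_mem (hψ y) hy
  exact Ideal.pow_right_mono h𝔞 n (Ideal.map_pow ψ 𝔞 n ▸ Ideal.mem_map_of_mem ψ hx)

theorem map_sub_self_mem_pow_add (hψ : ∀ x, ψ x - x ∈ 𝔞 ^ (s + 1)) {n : ℕ} {x : R}
    (hx : x ∈ 𝔞 ^ n) : ψ x - x ∈ 𝔞 ^ (n + s) := by
  have hψ' : ∀ x, ψ x - x ∈ 𝔞 := fun x => Ideal.pow_le_self s.succ_ne_zero (hψ x)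
  induction n generalizing x with
  | zero => exact Ideal.pow_le_pow_right (by omega) (hψ x)
  | succ n ih =>
    rw [pow_succ] at hx
    induction hx using Submodule.mul_induction_on' with
    | mem_mul_mem a ha b hb =>
      have hleft : (ψ a - a) * ψ b ∈ 𝔞 ^ (n + 1 + s) := by
        rw [show n + 1 + s = n + s + 1 by omega, pow_succ]
        exact Ideal.mul_mem_mul (ih ha)
          (by simpa using map_mem_pow hψ' (n := 1) (by simpa using hb))
      have hright : a * (ψ b - b) ∈ 𝔞 ^ (n + 1 + s) := by
        rw [show n + 1 + s = n + (s + 1) by omega, pow_add]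
        exact Ideal.mul_mem_mul ha (hψ b)
      rw [map_mul, show ψ a * ψ b - a * b = (ψ a - a) * ψ b + a * (ψ b - b) by ring]
      exact add_mem hleft hright
    | add a _ b _ ha hb =>
      rw [map_add, add_sub_add_comm]
      exact add_mem ha hb

theorem iterate_map_sub_self_mem_pow_add (hψ : ∀ x, ψ x - x ∈ 𝔞 ^ (s + 1)) {n : ℕ} {x : R}
    (hx : x ∈ 𝔞 ^ n) (j : ℕ) : (fun y => ψ y - y)^[j] x ∈ 𝔞 ^ (n + s * j) := by
  induction j with
  | zero => exact hx
  | succ j ih =>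
    rw [Function.iterate_succ_apply', mul_add_one, ← add_assoc]
    exact map_sub_self_mem_pow_add hψ ih

theorem iterate_map_mem_pow (hψ : ∀ x, ψ x - x ∈ 𝔞) {n : ℕ} {x : R} (hx : x ∈ 𝔞 ^ n) (k : ℕ) :
    ψ^[k] x ∈ 𝔞 ^ n :=
  Set.MapsTo.iterate (fun _ => map_mem_pow hψ) k hx

theorem exists_forall_iterate_sub_self_mem (𝔞 : Ideal R) [Finite (R ⧸ 𝔞)] :
    ∃ M, 0 < M ∧ ∀ φ : R ≃+* R, 𝔞.map φ = 𝔞 → ∀ x, φ^[M] x - x ∈ 𝔞 := by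
  have : Finite (RingAut (R ⧸ 𝔞)) := DFunLike.finite _
  refine ⟨Nat.card (RingAut (R ⧸ 𝔞)), Nat.card_pos, fun φ h𝔞 x => ?_⟩
  let φ' : RingAut (R ⧸ 𝔞) := Ideal.quotientEquiv 𝔞 𝔞 φ h𝔞.symm
  have hsemiconj : Function.Semiconj (Ideal.Quotient.mk 𝔞) φ φ' := fun _ => rfl
  rw [← Ideal.Quotient.eq, (hsemiconj.iterate_right _).eq, ← RingAut.coe_pow, pow_card_eq_one',
    RingAut.one_apply]

end AdicFiltration

section Norm

variable (p : ℕ) [Fact p.Prime] {K : Type*} [NormedField K]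

theorem inv_pow_le_norm_factorial [NormedAlgebra ℚ_[p] K] (j : ℕ) :
    ((p : ℝ)⁻¹) ^ j ≤ ‖(j.factorial : K)‖ := by
  have hp := (Fact.out : p.Prime)
  have hval : padicValNat p j.factorial ≤ j := by
    have h := sub_one_mul_padicValNat_factorial (p := p) j
    nlinarith [Nat.sub_le j (p.digits j).sum, Nat.le_sub_one_of_lt hp.one_lt]
  calc ((p : ℝ)⁻¹) ^ j = (p : ℝ) ^ (-(j : ℤ)) := by rw [zpow_neg, zpow_natCast, inv_pow]
    _ ≤ (p : ℝ) ^ (-(padicValNat p j.factorial : ℤ)) :=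
      zpow_le_zpow_right₀ (by exact_mod_cast hp.one_le) (by omega)
    _ = ‖(j.factorial : ℚ_[p])‖ := by
      rw [Padic.norm_eq_zpow_neg_valuation (Nat.cast_ne_zero.2 j.factorial_ne_zero),
        Padic.valuation_natCast]
    _ = ‖(j.factorial : K)‖ := by rw [← norm_algebraMap' K, map_natCast]

variable {R : Type*} [CommRing R] {z : R →+* K} {ρ : ℝ}

theorem norm_map_le_pow {𝔞 : Ideal R} [IsUltrametricDist K] (hz : ∀ x, ‖z x‖ ≤ 1)
    (h𝔞 : ∀ x ∈ 𝔞, ‖z x‖ ≤ ρ) {n : ℕ} {x : R} (hx : x ∈ 𝔞 ^ n) : ‖z x‖ ≤ ρ ^ n := by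
  induction n generalizing x with
  | zero => simpa using hz x
  | succ n ih =>
    rw [pow_succ] at hx
    induction hx using Submodule.mul_induction_on' with
    | mem_mul_mem a ha b hb =>
      rw [map_mul, norm_mul, pow_succ]
      exact mul_le_mul (ih ha) (h𝔞 b hb) (norm_nonneg _) ((norm_nonneg _).trans (ih ha))
    | add a _ b _ ha hb =>
      rw [map_add]
      exact (IsUltrametricDist.norm_add_le_max _ _).trans (max_le ha hb)

theorem norm_map_le_one [IsLocalRing R] [Finite (IsLocalRing.ResidueField R)]
    [IsUltrametricDist K] (h : ∀ x ∈ IsLocalRing.maximalIdeal R, ‖z x‖ ≤ 1) (x : R) :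
    ‖z x‖ ≤ 1 := by
  have := Fintype.ofFinite (IsLocalRing.ResidueField R)
  set q := Fintype.card (IsLocalRing.ResidueField R)
  have hmem : x ^ q - x ∈ IsLocalRing.maximalIdeal R := by
    rw [← IsLocalRing.residue_eq_zero_iff, map_sub, map_pow, FiniteField.pow_card, sub_self]
  by_contra! hx
  have hlt : ‖z x‖ < ‖z (x ^ q)‖ := by
    rw [map_pow, norm_pow]
    exact lt_self_pow₀ hx Fintype.one_lt_card
  have hle : ‖z (x ^ q)‖ ≤ max ‖z (x ^ q - x)‖ ‖z x‖ := by
    simpa using IsUltrametricDist.norm_add_le_max (z (x ^ q - x)) (z x)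
  exact (hle.trans (max_le ((h _ hmem).trans hx.le) le_rfl)).not_gt hlt

theorem norm_map_le_of_mem_span [IsUltrametricDist K] (hz : ∀ x, ‖z x‖ ≤ 1) (hρ : 0 ≤ ρ)
    {S : Set R} (hS : ∀ x ∈ S, ‖z x‖ ≤ ρ) {x : R} (hx : x ∈ Ideal.span S) : ‖z x‖ ≤ ρ := by
  induction hx using Submodule.span_induction with
  | mem x hx => exact hS x hx
  | zero => simpa using hρ
  | add x y _ _ hx hy =>
    rw [map_add]
    exact (IsUltrametricDist.norm_add_le_max _ _).trans (max_le hx hy)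
  | smul a x _ hx =>
    rw [smul_eq_mul, map_mul, norm_mul]
    exact (mul_le_of_le_one_left (norm_nonneg _) (hz a)).trans hx

end Norm

section Interpolation

open Filter Topology

variable (p : ℕ) [Fact p.Prime] {K : Type*} [NormedField K] [NormedAlgebra ℚ_[p] K]

theorem finite_or_eq_univ_setOf_eq_zero_of_norm_fwdDiff_le {u : ℕ → K} {C δ : ℝ} (hδ : 0 ≤ δ)
    (hδp : δ < (p : ℝ)⁻¹) (hu : ∀ j, ‖(fwdDiff 1)^[j] u 0‖ ≤ C * δ ^ j) :
    {n | u n = 0}.Finite ∨ {n | u n = 0} = Set.univ := by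
  have := IsUltrametricDist.of_normedAlgebra ℚ_[p] (L := K)
  have : CharZero K := charZero_of_injective_algebraMap (algebraMap ℚ_[p] K).injective
  have hp : (0 : ℝ) < p := Nat.cast_pos.2 (Fact.out : p.Prime).pos
  have hgeom : Tendsto (fun j : ℕ => C * (δ * p) ^ j) atTop (𝓝 0) := by
    simpa using (tendsto_pow_atTop_nhds_zero_of_lt_one (by positivity)
      ((lt_inv_mul_iff₀' hp).1 (by simpa using hδp))).const_mul C
  refine finite_or_eq_univ_setOf_eq_zero (squeeze_zero_norm (fun j => ?_) hgeom)
  calc ‖(fwdDiff 1)^[j] u 0 / (j.factorial : K)‖ ≤ C * δ ^ j / (p : ℝ)⁻¹ ^ j := by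
        rw [norm_div]
        exact div_le_div₀ ((norm_nonneg _).trans (hu j)) (hu j) (by positivity)
          (inv_pow_le_norm_factorial p j)
    _ = C * (δ * p) ^ j := by rw [inv_pow, div_inv_eq_mul, mul_pow, mul_assoc]

theorem finite_or_eq_univ_setOf_hasSum_iterate [CompleteSpace K] {R ι : Type*} [CommRing R]
    {𝔞 : Ideal R} {s : ℕ} {ψ : R →+* R} (hψ : ∀ x, ψ x - x ∈ 𝔞 ^ (s + 1)) {z : R →+* K} {ρ : ℝ}
    (hz : ∀ n, ∀ x ∈ 𝔞 ^ n, ‖z x‖ ≤ ρ ^ n) (hρ : 0 ≤ ρ) (hρs : ρ ^ s < (p : ℝ)⁻¹) {a : ι → K}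
    {w : ι → ℕ} (ha : Tendsto (fun i => ‖a i‖ * ρ ^ w i) cofinite (𝓝 0)) {g : ι → R}
    (hg : ∀ i, g i ∈ 𝔞 ^ w i) :
    {n | HasSum (fun i => a i * z (ψ^[n] (g i))) 0}.Finite ∨
      {n | HasSum (fun i => a i * z (ψ^[n] (g i))) 0} = Set.univ := by
  have := IsUltrametricDist.of_normedAlgebra ℚ_[p] (L := K)
  let u : ℕ → K := fun n => ∑' i, a i * z (ψ^[n] (g i))
  have hu : ∀ n, HasSum (fun i => a i * z (ψ^[n] (g i))) (u n) := fun n => by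
    refine (NonarchimedeanAddGroup.summable_of_tendsto_cofinite_zero
      (squeeze_zero_norm (fun i => ?_) ha)).hasSum
    have hmem := iterate_map_mem_pow (fun x => Ideal.pow_le_self s.succ_ne_zero (hψ x)) (hg i) n
    rw [norm_mul]
    exact mul_le_mul_of_nonneg_left (hz _ _ hmem) (norm_nonneg _)
  obtain ⟨C, hC⟩ := ha.bddAbove_range_of_cofinite
  replace hC : ∀ i, ‖a i‖ * ρ ^ w i ≤ max C 0 := fun i => (hC ⟨i, rfl⟩).trans (le_max_left _ _)
  have hdiff : ∀ i j, (fwdDiff 1)^[j] (fun n => a i * z (ψ^[n] (g i))) 0 =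
      a i * z ((fun y => ψ y - y)^[j] (g i)) := fun i j =>
    congrFun (fwdDiff_iterate_map_iterate ψ
      ((AddMonoidHom.mulLeft (a i)).comp z.toAddMonoidHom) (g i) j) 0
  have hΔ : ∀ j, ‖(fwdDiff 1)^[j] u 0‖ ≤ max C 0 * (ρ ^ s) ^ j := fun j => by
    rw [← (hasSum_fwdDiff_iterate hu 1 j 0).tsum_eq]
    refine IsUltrametricDist.norm_tsum_le_of_forall_le_of_nonneg (by positivity) fun i => ?_
    rw [hdiff]
    calc ‖a i * z ((fun y => ψ y - y)^[j] (g i))‖ ≤ ‖a i‖ * ρ ^ (w i + s * j) := by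
          rw [norm_mul]
          exact mul_le_mul_of_nonneg_left
            (hz _ _ (iterate_map_sub_self_mem_pow_add hψ (hg i) j)) (norm_nonneg _)
      _ = ‖a i‖ * ρ ^ w i * (ρ ^ s) ^ j := by rw [pow_add, pow_mul, mul_assoc]
      _ ≤ _ := mul_le_mul_of_nonneg_right (hC i) (by positivity)
  simpa only [(hu _).summable.hasSum_iff] using
    finite_or_eq_univ_setOf_eq_zero_of_norm_fwdDiff_le p (by positivity) hρs hΔ

theorem finite_or_eq_univ_setOf_hasSum_eval [CompleteSpace K] {R σ : Type*} [CommRing R]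
    [Fintype σ] {𝔞 : Ideal R} {s : ℕ} {ψ : R →+* R} (hψ : ∀ x, ψ x - x ∈ 𝔞 ^ (s + 1))
    {z : R →+* K} {ρ : ℝ} (hz : ∀ x, ‖z x‖ ≤ 1) (hz𝔞 : ∀ x ∈ 𝔞, ‖z x‖ ≤ ρ)
    (hρs : ρ ^ s < (p : ℝ)⁻¹) {x : σ → R} (hx : ∀ i, x i ∈ 𝔞) {f : MvPowerSeries σ K}
    (hf : f.IsRestricted fun _ => ρ) :
    {n | HasSum (fun d => f.coeff d * ∏ i, z (ψ^[n] (x i)) ^ d i) 0}.Finite ∨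
      {n | HasSum (fun d => f.coeff d * ∏ i, z (ψ^[n] (x i)) ^ d i) 0} = Set.univ := by
  have := IsUltrametricDist.of_normedAlgebra ℚ_[p] (L := K)
  have hmem : ∀ d : σ →₀ ℕ, ∏ i, x i ^ d i ∈ 𝔞 ^ d.degree := fun d => by
    rw [Finsupp.degree_eq_sum, ← Finset.prod_pow_eq_pow_sum]
    exact Ideal.prod_mem_prod fun i _ => Ideal.pow_mem_pow (hx i) _
  have hlim : Tendsto (fun d => ‖f.coeff d‖ * ρ ^ d.degree) cofinite (𝓝 0) := by
    simpa only [MvPowerSeries.IsRestricted, Finsupp.prod, Finset.prod_pow_eq_pow_sum,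
      ← Finsupp.degree_apply] using hf
  have hρ : 0 ≤ ρ := (norm_nonneg _).trans (hz𝔞 0 𝔞.zero_mem)
  have heval : ∀ n (d : σ →₀ ℕ),
      z (ψ^[n] (∏ i, x i ^ d i)) = ∏ i, z (ψ^[n] (x i)) ^ d i := fun n d => by
    simp only [← RingHom.coe_pow, map_prod, map_pow]
  simpa only [heval] using finite_or_eq_univ_setOf_hasSum_iterate p hψ
    (fun n x hx => norm_map_le_pow hz hz𝔞 hx) hρ hρs hlim hmem

end Interpolation

section Semilinear

theorem finite_or_eq_univ_setOf_forall_mem {α β : Type*} {F : Set β} {P : β → α → Prop}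
    (h : ∀ f ∈ F, {x | P f x}.Finite ∨ {x | P f x} = Set.univ) :
    {x | ∀ f ∈ F, P f x}.Finite ∨ {x | ∀ f ∈ F, P f x} = Set.univ := by
  by_cases hF : ∃ f ∈ F, {x | P f x}.Finite
  · obtain ⟨f, hf, hfin⟩ := hF
    exact .inl (hfin.subset fun x hx => hx f hf)
  · refine .inr (Set.eq_univ_of_forall fun x f hf => ?_)
    exact Set.eq_univ_iff_forall.1 ((h f hf).resolve_left fun hfin => hF ⟨f, hf, hfin⟩) x

theorem isSemilinearWithPeriod_of_finite_or_eq_univ {M : ℕ} (hM : 0 < M) {A : Set ℕ}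
    (h : ∀ a, {n | a + M * n ∈ A}.Finite ∨ {n | a + M * n ∈ A} = Set.univ) :
    IsSemilinearWithPeriod M A := by
  classical
  let T := (Finset.range M).filter fun a => {n | a + M * n ∈ A} = Set.univ
  have hfin : {m | m ∈ A ∧ m % M ∉ T}.Finite := by
    refine ((Finset.range M \ T).finite_toSet.biUnion
      (t := fun a => (fun n => a + M * n) '' {n | a + M * n ∈ A}) fun a ha => ?_).subset
      fun m ⟨hmA, hmT⟩ => ?_
    · refine ((h a).resolve_right fun huniv => ?_).image _
      exact (Finset.mem_sdiff.1 ha).2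
        (Finset.mem_filter.2 ⟨(Finset.mem_sdiff.1 ha).1, huniv⟩)
    · have hm := Nat.mod_add_div m M
      exact Set.mem_biUnion
        (Finset.mem_sdiff.2 ⟨Finset.mem_range.2 (Nat.mod_lt m hM), hmT⟩)
        ⟨m / M, show m % M + M * (m / M) ∈ A from hm.symm ▸ hmA, hm⟩
  refine ⟨hfin.toFinset, T, fun a ha => Finset.mem_range.1 (Finset.mem_filter.1 ha).1, ?_⟩
  ext m
  simp only [Set.Finite.mem_toFinset, Set.mem_ofPred_eq]
  constructor
  · intro hm
    by_cases hmT : m % M ∈ T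
    · exact .inr ⟨_, hmT, m / M, by rw [mul_comm, Nat.mod_add_div]⟩
    · exact .inl ⟨hm, hmT⟩
  · rintro (hm | ⟨a, ha, j, rfl⟩)
    · exact hm.1
    · rw [mul_comm]
      exact Set.eq_univ_iff_forall.1 (Finset.mem_filter.1 ha).2 j

end Semilinear

section PowerSeries

open IsLocalRing MvPowerSeries

variable {σ A : Type*} [CommRing A]

theorem mem_span_X_image {s : Finset σ} {f : MvPowerSeries σ A}
    (hf : ∀ d : σ →₀ ℕ, (∀ i ∈ s, d i = 0) → coeff d f = 0) :
    f ∈ Ideal.span (X '' s : Set (MvPowerSeries σ A)) := by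
  classical
  induction s using Finset.induction_on generalizing f with
  | empty =>
    have : f = 0 := MvPowerSeries.ext fun d => by simpa using hf d
    exact this ▸ zero_mem _
  | insert i s _ ih =>
    let g : MvPowerSeries σ A := fun d => if d i = 0 then coeff d f else 0
    have hg : ∀ d, coeff d g = if d i = 0 then coeff d f else 0 := fun _ => rfl
    have hg_mem : g ∈ Ideal.span (X '' s : Set (MvPowerSeries σ A)) := ih fun d hd => by
      rw [hg]
      split_ifs with hdi
      · exact hf d (by simpa [hdi] using hd)
      · rfl
    have hfg : X i ∣ f - g := X_dvd_iff.2 fun d hd => by rw [map_sub, hg, if_pos hd, sub_self]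
    rw [Finset.coe_insert, Set.image_insert_eq, ← sub_add_cancel f g]
    exact add_mem (Ideal.mem_of_dvd _ hfg (Ideal.subset_span (Set.mem_insert _ _)))
      (Ideal.span_mono (Set.subset_insert _ _) hg_mem)

variable [IsLocalRing A]

theorem mem_maximalIdeal_mvPowerSeries_iff {f : MvPowerSeries σ A} :
    f ∈ maximalIdeal (MvPowerSeries σ A) ↔ constantCoeff f ∈ maximalIdeal A := by
  rw [mem_maximalIdeal, mem_maximalIdeal, mem_nonunits_iff, mem_nonunits_iff,
    isUnit_iff_constantCoeff]

theorem maximalIdeal_mvPowerSeries_eq_span [Finite σ] {T : Set A}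
    (hT : maximalIdeal A = Ideal.span T) :
    maximalIdeal (MvPowerSeries σ A) = Ideal.span (C '' T ∪ Set.range X) := by
  have := Fintype.ofFinite σ
  refine le_antisymm (fun f hf => ?_) (Ideal.span_le.2 ?_)
  · have hconst : C (constantCoeff f) ∈ Ideal.span (C '' T : Set (MvPowerSeries σ A)) := by
      rw [← Ideal.map_span, ← hT]
      exact Ideal.mem_map_of_mem C (mem_maximalIdeal_mvPowerSeries_iff.1 hf)
    have htail : f - C (constantCoeff f) ∈
        Ideal.span (X '' (Finset.univ : Finset σ) : Set (MvPowerSeries σ A)) :=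
      mem_span_X_image fun d hd => by
        obtain rfl : d = 0 := Finsupp.ext fun i => hd i (Finset.mem_univ i)
        simp
    rw [Finset.coe_univ, Set.image_univ] at htail
    rw [Ideal.span_union, ← add_sub_cancel (C (constantCoeff f)) f]
    exact Submodule.add_mem_sup hconst htail
  · rintro _ (⟨t, ht, rfl⟩ | ⟨i, rfl⟩) <;>
      rw [SetLike.mem_coe, mem_maximalIdeal_mvPowerSeries_iff]
    · rw [constantCoeff_C, hT]
      exact Ideal.subset_span ht
    · rw [constantCoeff_X]
      exact zero_mem _

instance finite_residueField_mvPowerSeries [Finite (ResidueField A)] :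
    Finite (ResidueField (MvPowerSeries σ A)) :=
  have : IsLocalHom (constantCoeff (σ := σ) (R := A)) :=
    ⟨fun _ => isUnit_iff_constantCoeff.2⟩
  Finite.of_injective _ (ResidueField.map (constantCoeff (σ := σ) (R := A))).injective

end PowerSeries

section Point

open IsLocalRing MvPowerSeries

variable {ℓ : ℕ} [Fact ℓ.Prime] {r N : ℕ}

theorem maximalIdeal_lam : maximalIdeal (Lam ℓ r) = Ideal.span {(ℓ : Lam ℓ r)} :=
  (WittVector.irreducible ℓ).maximalIdeal_eq

instance finite_residueField_lam : Finite (ResidueField (Lam ℓ r)) :=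
  Finite.of_equiv _ ((Ideal.quotEquivOfEq maximalIdeal_lam).trans
    (WittVector.quotientPEquiv (p := ℓ) (k := GaloisField ℓ r))).symm.toEquiv

theorem maximalIdeal_powerSeriesRing : maximalIdeal (PowerSeriesRing ℓ r N) =
    Ideal.span (C '' {(ℓ : Lam ℓ r)} ∪ Set.range X) :=
  maximalIdeal_mvPowerSeries_eq_span maximalIdeal_lam

theorem fg_maximalIdeal_powerSeriesRing : (maximalIdeal (PowerSeriesRing ℓ r N)).FG := by
  rw [maximalIdeal_powerSeriesRing]
  exact Submodule.fg_span (((Set.finite_singleton _).image _).union (Set.finite_range _))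

theorem isTopologicallyNilpotent_of_mem_maximalIdeal {f : PowerSeriesRing ℓ r N}
    (hf : f ∈ maximalIdeal (PowerSeriesRing ℓ r N)) : IsTopologicallyNilpotent f := by
  rw [mem_maximalIdeal_mvPowerSeries_iff, maximalIdeal_lam] at hf
  let : WithIdeal (Lam ℓ r) := ⟨Ideal.span {(ℓ : Lam ℓ r)}⟩
  have := (Ideal.span {(ℓ : Lam ℓ r)}).isLinearTopology
  exact LinearTopology.isTopologicallyNilpotent_of_constantCoeff
    (WithIdeal.isTopologicallyNilpotent_of_mem hf)

theorem Point.norm_hom_lt_one (z : Point ℓ r N) {f : PowerSeriesRing ℓ r N}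
    (hf : f ∈ maximalIdeal (PowerSeriesRing ℓ r N)) : ‖z.hom f‖ < 1 :=
  tendsto_pow_atTop_nhds_zero_iff_norm_lt_one.1
    ((isTopologicallyNilpotent_of_mem_maximalIdeal hf).map z.continuous_hom)

theorem norm_hom_le_of_mem_closedBall {c : ℝ} (hc : c ≤ 1) {z : Point ℓ r N}
    (hz : z ∈ closedBall ℓ r N c) {f : PowerSeriesRing ℓ r N}
    (hf : f ∈ maximalIdeal (PowerSeriesRing ℓ r N)) : ‖z.hom f‖ ≤ (ℓ : ℝ) ^ (-c) := by
  have hℓ : 1 < (ℓ : ℝ) := Nat.one_lt_cast.2 (Fact.out : ℓ.Prime).one_lt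
  rw [maximalIdeal_powerSeriesRing] at hf
  refine norm_map_le_of_mem_span (norm_map_le_one fun x hx => (z.norm_hom_lt_one hx).le)
    (by positivity) ?_ hf
  rintro _ (⟨_, rfl, rfl⟩ | ⟨i, rfl⟩)
  · calc ‖z.hom (C (ℓ : Lam ℓ r))‖ = ‖(ℓ : ℚ_[ℓ])‖ := by
          rw [map_natCast, map_natCast, ← PadicComplex.norm_extends' ℓ (ℓ : ℚ_[ℓ])]
          simp
      _ = (ℓ : ℝ) ^ (-1 : ℝ) := by rw [Padic.norm_p, Real.rpow_neg_one]
      _ ≤ (ℓ : ℝ) ^ (-c) := Real.rpow_le_rpow_of_exponent_le hℓ.le (neg_le_neg hc)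
  · exact hz i

theorem norm_coe_complexInt_le_one (x : 𝓞_ℂ_[ℓ]) : ‖(x : ℂ_[ℓ])‖ ≤ 1 := by
  rw [PadicComplex.norm_eq_norm ℓ (x : ℂ_[ℓ])]
  exact Valued.toNormedField.norm_le_one_iff.2 x.2

theorem isRestricted_of_norm_coeff_le_one {σ S : Type*} [Finite σ] [NormedRing S] {ρ : ℝ}
    (hρ0 : 0 ≤ ρ) (hρ1 : ρ < 1) {f : MvPowerSeries σ S} (hf : ∀ d, ‖f.coeff d‖ ≤ 1) :
    f.IsRestricted fun _ => ρ := by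
  have hdeg : Filter.Tendsto (Finsupp.degree : (σ →₀ ℕ) → ℕ) Filter.cofinite Filter.atTop :=
    Filter.tendsto_atTop.2 fun n => by
      refine (Finsupp.finite_of_degree_le n).subset fun d hd => ?_
      exact (not_le.1 (show ¬ n ≤ d.degree from hd)).le
  refine squeeze_zero (fun d => ?_) (fun d => ?_)
    ((tendsto_pow_atTop_nhds_zero_of_lt_one hρ0 hρ1).comp hdeg)
  · exact mul_nonneg (norm_nonneg _) (Finset.prod_nonneg fun _ _ => pow_nonneg hρ0 _)
  · rw [Finsupp.prod, Finset.prod_pow_eq_pow_sum, ← Finsupp.degree_apply]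
    exact mul_le_of_le_one_left (pow_nonneg hρ0 _) (hf d)

variable (ℓ) in
theorem rpow_neg_lt_one {c : ℝ} (hc : 0 < c) : (ℓ : ℝ) ^ (-c) < 1 :=
  Real.rpow_lt_one_of_one_lt_of_neg (Nat.one_lt_cast.2 (Fact.out : ℓ.Prime).one_lt)
    (neg_lt_zero.2 hc)

theorem X_mem_maximalIdeal (i : Fin N) :
    (X i : PowerSeriesRing ℓ r N) ∈ maximalIdeal (PowerSeriesRing ℓ r N) := by
  rw [maximalIdeal_powerSeriesRing]
  exact Ideal.subset_span (.inr ⟨i, rfl⟩)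

theorem isRestricted_map_subtype {σ : Type*} [Finite σ] {ρ : ℝ} (hρ0 : 0 ≤ ρ) (hρ1 : ρ < 1)
    (f : MvPowerSeries σ 𝓞_ℂ_[ℓ]) :
    (MvPowerSeries.map (PadicComplexInt ℓ).subtype f).IsRestricted fun _ => ρ :=
  isRestricted_of_norm_coeff_le_one hρ0 hρ1 fun d => by
    rw [coeff_map]
    exact norm_coe_complexInt_le_one (f.coeff d)

theorem map_iterate_hom (φ : PowerSeriesRing ℓ r N ≃+* PowerSeriesRing ℓ r N) (hφ : Continuous φ)
    (m : ℕ) (z : Point ℓ r N) (f : PowerSeriesRing ℓ r N) :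
    ((Point.map φ hφ)^[m] z).hom f = z.hom (φ^[m] f) := by
  induction m generalizing z with
  | zero => rfl
  | succ m ih =>
    rw [Function.iterate_succ_apply, ih, Function.iterate_succ_apply']
    rfl

theorem map_iterate_mem_vanishingLocus_iff (φ : PowerSeriesRing ℓ r N ≃+* PowerSeriesRing ℓ r N)
    (hφ : Continuous φ) (z : Point ℓ r N) (I : Ideal (MvPowerSeries (Fin N) 𝓞_ℂ_[ℓ])) (m : ℕ) :
    (Point.map φ hφ)^[m] z ∈ vanishingLocus r I ↔
      ∀ f ∈ MvPowerSeries.map (PadicComplexInt ℓ).subtype '' (I : Set _),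
        HasSum (fun d => f.coeff d * ∏ i, z.hom (φ^[m] (X i)) ^ d i) 0 := by
  simp [vanishingLocus, Point.Kills, Point.coord, map_iterate_hom]

end Point

end LocalMordellLang

open IsLocalRing LocalMordellLang in
theorem lemma4p7_general (p : ℕ) [Fact p.Prime] {K R σ : Type*} [NormedField K]
    [NormedAlgebra ℚ_[p] K] [CompleteSpace K] [CommRing R] [IsLocalRing R]
    [Finite (ResidueField R)] [Fintype σ] (hR : (maximalIdeal R).FG) {ρ : ℝ} (hρ : ρ < 1) :
    ∃ M : ℕ, 0 < M ∧
      ∀ (φ : R ≃+* R) (z : R →+* K), (∀ x ∈ maximalIdeal R, ‖z x‖ ≤ ρ) →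
      ∀ x : σ → R, (∀ i, x i ∈ maximalIdeal R) →
      ∀ F : Set (MvPowerSeries σ K), (∀ f ∈ F, f.IsRestricted fun _ => ρ) →
        IsSemilinearWithPeriod M
          {m | ∀ f ∈ F, HasSum (fun d => f.coeff d * ∏ i, z (φ^[m] (x i)) ^ d i) 0} := by
  have hp : (0 : ℝ) < p := Nat.cast_pos.2 (Fact.out : p.Prime).pos
  obtain ⟨s, hs⟩ := exists_pow_lt_of_lt_one (inv_pos.2 hp) hρ
  have : Finite (R ⧸ maximalIdeal R) := inferInstanceAs (Finite (ResidueField R))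
  have := Ideal.finite_quotient_pow hR (s + 1)
  have := IsUltrametricDist.of_normedAlgebra ℚ_[p] (L := K)
  obtain ⟨M, hM, hφM⟩ := exists_forall_iterate_sub_self_mem (maximalIdeal R ^ (s + 1))
  refine ⟨M, hM, fun φ z hz x hx F hF => ?_⟩
  refine isSemilinearWithPeriod_of_finite_or_eq_univ hM fun a =>
    finite_or_eq_univ_setOf_forall_mem fun f hf => ?_
  have hstable : (maximalIdeal R ^ (s + 1)).map φ = maximalIdeal R ^ (s + 1) := by
    rw [Ideal.map_pow, map_ringEquiv_maximalIdeal]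
  let ψ : R →+* R := (φ ^ M : RingAut R)
  have hψ : ∀ y, ψ y - y ∈ maximalIdeal R ^ (s + 1) := fun y => by
    simpa [ψ, RingAut.coe_pow] using hφM φ hstable y
  let ζ : R →+* K := z.comp (φ ^ a : RingAut R)
  have hζ : ∀ y ∈ maximalIdeal R, ‖ζ y‖ ≤ ρ := fun y hy =>
    hz _ ((map_mem_nonunits_iff (φ ^ a : RingAut R) y).2 hy)
  have horbit : ∀ n y, z (φ^[a + M * n] y) = ζ (ψ^[n] y) := fun n y => by
    simp [ζ, ψ, RingAut.coe_pow, Function.iterate_add_apply, Function.iterate_mul]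
  simpa only [horbit] using finite_or_eq_univ_setOf_hasSum_eval p hψ
    (norm_map_le_one fun y hy => (hζ y hy).trans hρ.le) hζ hs hx (hF f hf)

open LocalMordellLang in
theorem lemma4p7 (ℓ : ℕ) [Fact ℓ.Prime] (r N : ℕ) (hr : 0 < r) (c : ℝ) (hc0 : 0 < c)
    (hc1 : c < 1) :
    ∃ M : ℕ, 0 < M ∧
      ∀ (φ : LocalMordellLang.PowerSeriesRing ℓ r N ≃+* LocalMordellLang.PowerSeriesRing ℓ r N)
        (hφ : Continuous φ),
      ∀ z ∈ LocalMordellLang.closedBall ℓ r N c,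
      ∀ I : Ideal (MvPowerSeries (Fin N) 𝓞_ℂ_[ℓ]),
        LocalMordellLang.IsSemilinearWithPeriod M
          {m : ℕ | (LocalMordellLang.Point.map φ hφ)^[m] z ∈
            LocalMordellLang.vanishingLocus r I} := by
  obtain ⟨M, hM, h⟩ := lemma4p7_general ℓ (K := ℂ_[ℓ]) (R := PowerSeriesRing ℓ r N)
    (σ := Fin N) fg_maximalIdeal_powerSeriesRing (rpow_neg_lt_one ℓ hc0)
  refine ⟨M, hM, fun φ hφ z hz I => ?_⟩
  simp only [map_iterate_mem_vanishingLocus_iff]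
  exact h φ z.hom (fun _ => norm_hom_le_of_mem_closedBall hc1.le hz) _ X_mem_maximalIdeal _
    (Set.forall_mem_image.2 fun f _ =>
      isRestricted_map_subtype (by positivity) (rpow_neg_lt_one ℓ hc0) f)
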